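/- Let $E$ be a complex Banach space, let $E_{\mathbb R}$ be $E$ regarded as a real Banach space, and let $(E_{\mathbb R})^*$ be its real dual. For $f:(E_{\mathbb R})^*\to\mathbb R$ put $$\|f\|_{\mathrm{FBL}[E_{\mathbb R}]}=\sup\Big\{\sum_{j=1}^m|f(x_j^*)| : m\in\mathbb N,\ x_1^*,\dots,x_m^*\in (E_{\mathbb R})^*,\ \sup_{\|x\|\le 1}\sum_{j=1}^m|x_j^*(x)|\le 1\Big\},$$ let $H_1[E_{\mathbb R}]$ be the Banach lattice (pointwise order) of the positively homogeneous $f$ for which this is finite, and let $\mathrm{FBL}[E_{\mathbb R}]$ be the closed sublattice of $H_1[E_{\mathbb R}]$ generated by the evaluations $\delta_{E_{\mathbb R}}(x):x^*\mapsto x^*(x)$, $x\in E$. The free complex Banach lattice $\mathrm{FBL}_{\mathbb C}[E]$ is the complexification $\mathrm{FBL}[E_{\mathbb R}]\oplus i\,\mathrm{FBL}[E_{\mathbb R}]$, a space of functions $(E_{\mathbb R})^*\to\mathbb C$, with the norm $$\|f\|=\sup\Big\{\sum_{j=1}^m|f(\operatorname{Re} z_j^*)| : m\in\mathbb N,\ z_1^*,\dots,z_m^*\in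 E^*,\ \sup_{\|z\|\le 1}\sum_{j=1}^m|z_j^*(z)|\le 1\Big\},$$ and $\delta_E:E\to \mathrm{FBL}_{\mathbb C}[E]$ is the map $\delta_E(z)=\delta_{E_{\mathbb R}}(z)-i\,\delta_{E_{\mathbb R}}(iz)$. A complex lattice homomorphism of $\mathrm{FBL}_{\mathbb C}[E]$ is the complexification of a lattice homomorphism of $\mathrm{FBL}[E_{\mathbb R}]$. Let $T:E\to E$ be a bounded $\mathbb C$-linear operator and let $\overline T:\mathrm{FBL}_{\mathbb C}[E]\to\mathrm{FBL}_{\mathbb C}[E]$ be the unique bounded complex lattice homomorphism such that $\overline T\,\delta_E=\delta_E\,T$. If $\lambda\in\sigma(T)\cap[0,\infty)$, then $\lambda\in\sigma(\overline T)$. -/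

import Mathlib

open scoped ENNReal

noncomputable section

namespace FreeBL

section TupleNorm

variable {𝕜 : Type*} [RCLike 𝕜] {X : Type*} [NormedAddCommGroup X] [NormedSpace 𝕜 X]
  {V : Type*} [NormedAddCommGroup V]

/-- The finite sequence `x` of functionals satisfies `sup_{z ∈ B_X} ∑ |x_i(z)| ≤ 1`. -/
def WeakOneLE {n : ℕ} (x : Fin n → (X →L[𝕜] 𝕜)) : Prop :=
  ∀ z : X, ‖z‖ ≤ 1 → ∑ i, ‖x i z‖ ≤ 1

/-- The extended norm
`sup {∑ |f(x_i)| : (x_i) a finite sequence in X^*, sup_{z ∈ B_X} ∑ |x_i(z)| ≤ 1}`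
of a function `f` on the dual of `X`. -/
def freeNorm (f : (X →L[𝕜] 𝕜) → V) : ℝ≥0∞ :=
  ⨆ (n : ℕ) (x : Fin n → (X →L[𝕜] 𝕜)) (_ : WeakOneLE x), ∑ i, ‖f (x i)‖ₑ

theorem le_freeNorm (f : (X →L[𝕜] 𝕜) → V) {n : ℕ} (x : Fin n → (X →L[𝕜] 𝕜))
    (hx : WeakOneLE x) : ∑ i, ‖f (x i)‖ₑ ≤ freeNorm f :=
  le_iSup_of_le n (le_iSup_of_le x (le_iSup_of_le hx le_rfl))

theorem freeNorm_le {f : (X →L[𝕜] 𝕜) → V} {C : ℝ≥0∞}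
    (h : ∀ (n : ℕ) (x : Fin n → (X →L[𝕜] 𝕜)), WeakOneLE x → ∑ i, ‖f (x i)‖ₑ ≤ C) :
    freeNorm f ≤ C :=
  iSup_le fun n => iSup_le fun x => iSup_le fun hx => h n x hx

theorem freeNorm_mono {W : Type*} [NormedAddCommGroup W] {f : (X →L[𝕜] 𝕜) → V}
    {g : (X →L[𝕜] 𝕜) → W} (h : ∀ x, ‖f x‖ ≤ ‖g x‖) : freeNorm f ≤ freeNorm g :=
  freeNorm_le fun _ x hx =>
    (Finset.sum_le_sum fun i _ => enorm_le_iff_norm_le.2 (h (x i))).trans (le_freeNorm g x hx)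

theorem freeNorm_add_of_le {W W' : Type*} [NormedAddCommGroup W] [NormedAddCommGroup W']
    {f : (X →L[𝕜] 𝕜) → V} {g : (X →L[𝕜] 𝕜) → W} {h : (X →L[𝕜] 𝕜) → W'}
    (hf : ∀ x, ‖f x‖ ≤ ‖g x‖ + ‖h x‖) : freeNorm f ≤ freeNorm g + freeNorm h := by
  refine freeNorm_le fun n x hx => ?_
  calc ∑ i, ‖f (x i)‖ₑ ≤ ∑ i, (‖g (x i)‖ₑ + ‖h (x i)‖ₑ) := by
        refine Finset.sum_le_sum fun i _ => ?_
        rw [← ofReal_norm, ← ofReal_norm, ← ofReal_norm,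
          ← ENNReal.ofReal_add (norm_nonneg _) (norm_nonneg _)]
        exact ENNReal.ofReal_le_ofReal (hf _)
    _ = ∑ i, ‖g (x i)‖ₑ + ∑ i, ‖h (x i)‖ₑ := Finset.sum_add_distrib
    _ ≤ _ := add_le_add (le_freeNorm g x hx) (le_freeNorm h x hx)

theorem freeNorm_smul_eq {R : Type*} [NormedField R] [NormedSpace R V] (c : R)
    (f : (X →L[𝕜] 𝕜) → V) : freeNorm (fun x => c • f x) = ‖c‖ₑ * freeNorm f := by
  unfold freeNorm
  simp only [enorm_smul, ← Finset.mul_sum, ENNReal.mul_iSup]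

end TupleNorm

section Real

variable {F : Type*} [NormedAddCommGroup F] [NormedSpace ℝ F]

/-- The space `H_1[F]` of positively homogeneous functions on `F^*` of finite norm. -/
def H1 (F : Type*) [NormedAddCommGroup F] [NormedSpace ℝ F] :
    Submodule ℝ ((F →L[ℝ] ℝ) → ℝ) where
  carrier := {f | (∀ (c : ℝ) (x : F →L[ℝ] ℝ), 0 ≤ c → f (c • x) = c * f x) ∧ freeNorm f < ∞}
  add_mem' := by
    rintro f g ⟨hf, hf'⟩ ⟨hg, hg'⟩
    refine ⟨fun c x hc => by simp [hf c x hc, hg c x hc, mul_add], ?_⟩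
    exact (freeNorm_add_of_le (fun x => norm_add_le _ _)).trans_lt (ENNReal.add_lt_top.2 ⟨hf', hg'⟩)
  zero_mem' := ⟨by simp, by simp [freeNorm]⟩
  smul_mem' := by
    rintro a f ⟨hf, hf'⟩
    refine ⟨fun c x hc => by simp [hf c x hc]; ring, ?_⟩
    exact (freeNorm_smul_eq a f).trans_lt (ENNReal.mul_lt_top (by simp) hf')

/-- The evaluation function `x^* ↦ x^*(x)`. -/
def evalAt (x : F) : (F →L[ℝ] ℝ) → ℝ := fun φ => φ x

/-- `p` is a norm-closed vector sublattice of `H_1[F]` (closed under `⊔`, hence under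
`f ⊓ g = -(-f ⊔ -g)`). -/
structure IsClosedSublattice (p : Submodule ℝ ((F →L[ℝ] ℝ) → ℝ)) : Prop where
  le_H1 : p ≤ H1 F
  sup_mem : ∀ f ∈ p, ∀ g ∈ p, f ⊔ g ∈ p
  closed : ∀ f ∈ H1 F, (∀ ε : ℝ≥0∞, 0 < ε → ∃ g ∈ p, freeNorm (f - g) < ε) → f ∈ p

/-- The free Banach lattice `FBL[F]`: the closed sublattice of `H_1[F]` generated by the
evaluation functions. -/
def FBL (F : Type*) [NormedAddCommGroup F] [NormedSpace ℝ F] :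
    Submodule ℝ ((F →L[ℝ] ℝ) → ℝ) :=
  sInf {p | IsClosedSublattice p ∧ ∀ x : F, evalAt x ∈ p}

theorem evalAt_mem_H1 (x : F) : evalAt x ∈ H1 F := by
  refine ⟨fun c φ _ => by simp [evalAt], ?_⟩
  refine lt_of_le_of_lt (freeNorm_le (C := ENNReal.ofReal (‖x‖)) fun n φ hφ => ?_)
    ENNReal.ofReal_lt_top
  simp only [evalAt, ← ofReal_norm]
  rw [← ENNReal.ofReal_sum_of_nonneg fun _ _ => norm_nonneg _]
  refine ENNReal.ofReal_le_ofReal ?_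
  rcases eq_or_ne x 0 with rfl | hx
  · simp
  · have hx' : 0 < ‖x‖ := norm_pos_iff.2 hx
    have := hφ (‖x‖⁻¹ • x) (by simp [norm_smul, hx'.ne'])
    simp only [map_smul, norm_smul, norm_inv, norm_norm, ← Finset.mul_sum] at this
    rwa [inv_mul_le_iff₀ hx', mul_one] at this

theorem isClosedSublattice_H1 : IsClosedSublattice (H1 F) where
  le_H1 := le_rfl
  sup_mem := by
    rintro f ⟨hf, hf'⟩ g ⟨hg, hg'⟩
    refine ⟨fun c x hc => ?_, ?_⟩
    · simp only [Pi.sup_apply, hf c x hc, hg c x hc]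
      exact (mul_max_of_nonneg _ _ hc).symm
    · refine (freeNorm_add_of_le (g := f) (h := g) fun x => ?_).trans_lt
        (ENNReal.add_lt_top.2 ⟨hf', hg'⟩)
      simp only [Pi.sup_apply, Real.norm_eq_abs]
      rcases le_total (f x) (g x) with h | h
      · simp [h]
      · simp [h]
  closed := fun f hf _ => hf

theorem FBL_le {p : Submodule ℝ ((F →L[ℝ] ℝ) → ℝ)} (hp : IsClosedSublattice p)
    (h : ∀ x : F, evalAt x ∈ p) : FBL F ≤ p :=
  sInf_le ⟨hp, h⟩

theorem evalAt_mem (x : F) : evalAt x ∈ FBL F := by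
  simp only [FBL, Submodule.mem_sInf]
  exact fun p hp => hp.2 x

theorem isClosedSublattice_FBL : IsClosedSublattice (FBL F) where
  le_H1 := FBL_le isClosedSublattice_H1 evalAt_mem_H1
  sup_mem := by
    intro f hf g hg
    simp only [FBL, Submodule.mem_sInf] at *
    exact fun p hp => hp.1.sup_mem f (hf p hp) g (hg p hp)
  closed := by
    intro f hf h
    simp only [FBL, Submodule.mem_sInf]
    intro p hp
    refine hp.1.closed f hf fun ε hε => ?_
    obtain ⟨g, hg, hg'⟩ := h ε hε
    exact ⟨g, FBL_le hp.1 hp.2 hg, hg'⟩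

/-- `FBL[F]` is a lattice in the pointwise order. -/
instance : Lattice (FBL F) :=
  Subtype.lattice (fun {f g} hf hg => isClosedSublattice_FBL.sup_mem f hf g hg)
    (fun {f g} hf hg => by
      have h := (FBL F).neg_mem (isClosedSublattice_FBL.sup_mem _ ((FBL F).neg_mem hf) _
        ((FBL F).neg_mem hg))
      rwa [neg_sup, neg_neg, neg_neg] at h)

theorem coe_sup (f g : FBL F) : ((f ⊔ g : FBL F) : (F →L[ℝ] ℝ) → ℝ) = (f : _ → ℝ) ⊔ g := rfl

end Real

section Complex

variable {E : Type*} [NormedAddCommGroup E] [NormedSpace ℂ E]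

/-- The real part of a complex functional, a functional on the underlying real space. -/
def rePart (z : E →L[ℂ] ℂ) : E →L[ℝ] ℝ := Complex.reCLM.comp (z.restrictScalars ℝ)

/-- The complexification `FBL[E_ℝ] ⊕ i FBL[E_ℝ]`, as the space of complex functions on
`(E_ℝ)^*` whose real and imaginary parts are in `FBL[E_ℝ]`. -/
def complexFBL (E : Type*) [NormedAddCommGroup E] [NormedSpace ℂ E] :
    Submodule ℂ ((E →L[ℝ] ℝ) → ℂ) where
  carrier := {f | (fun x => (f x).re) ∈ FBL E ∧ (fun x => (f x).im) ∈ FBL E}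
  add_mem' := fun hf hg => ⟨(FBL E).add_mem hf.1 hg.1, (FBL E).add_mem hf.2 hg.2⟩
  zero_mem' := ⟨(FBL E).zero_mem, (FBL E).zero_mem⟩
  smul_mem' := by
    rintro c f ⟨h1, h2⟩
    constructor
    · convert (FBL E).sub_mem ((FBL E).smul_mem c.re h1) ((FBL E).smul_mem c.im h2) using 1
      ext x; simp
    · convert (FBL E).add_mem ((FBL E).smul_mem c.re h2) ((FBL E).smul_mem c.im h1) using 1
      ext x; simp

/-- The free complex Banach lattice `FBL_ℂ[E]`. (A separate type, so that it carries the norm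
below and not the topology of pointwise convergence.) -/
def FBLC (E : Type*) [NormedAddCommGroup E] [NormedSpace ℂ E] : Type _ := complexFBL E

namespace FBLC

instance : AddCommGroup (FBLC E) := inferInstanceAs (AddCommGroup (complexFBL E))

instance : Module ℂ (FBLC E) := inferInstanceAs (Module ℂ (complexFBL E))

/-- The function on `(E_ℝ)^*` given by an element of `FBL_ℂ[E]`. -/
def toFun (f : FBLC E) : (E →L[ℝ] ℝ) → ℂ := f.1

instance : CoeFun (FBLC E) fun _ => (E →L[ℝ] ℝ) → ℂ := ⟨toFun⟩

@[ext] theorem ext {f g : FBLC E} (h : ∀ x, f x = g x) : f = g := Subtype.ext (funext h)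

@[simp] theorem add_apply (f g : FBLC E) (x : E →L[ℝ] ℝ) : (f + g) x = f x + g x := rfl

@[simp] theorem smul_apply (c : ℂ) (f : FBLC E) (x : E →L[ℝ] ℝ) : (c • f) x = c * f x := rfl

@[simp] theorem sub_apply (f g : FBLC E) (x : E →L[ℝ] ℝ) : (f - g) x = f x - g x := rfl

@[simp] theorem zero_apply (x : E →L[ℝ] ℝ) : (0 : FBLC E) x = 0 := rfl

/-- The real part of an element of `FBL_ℂ[E] = FBL[E_ℝ] ⊕ i FBL[E_ℝ]`. -/
def re (f : FBLC E) : FBL E := ⟨fun x => (f x).re, f.2.1⟩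

/-- The imaginary part of an element of `FBL_ℂ[E] = FBL[E_ℝ] ⊕ i FBL[E_ℝ]`. -/
def im (f : FBLC E) : FBL E := ⟨fun x => (f x).im, f.2.2⟩

/-- The element `f + i g` of `FBL_ℂ[E]`. -/
def mk (f g : FBL E) : FBLC E :=
  ⟨fun x => ⟨(f : (E →L[ℝ] ℝ) → ℝ) x, (g : (E →L[ℝ] ℝ) → ℝ) x⟩, f.2, g.2⟩

/-- `‖f‖ = sup {∑ |f(Re z_j^*)| : (z_j^*) finite in E^*, sup_{z ∈ B_E} ∑ |z_j^*(z)| ≤ 1}`;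
the supremum is finite by `norm_ne_top`. -/
instance : Norm (FBLC E) := ⟨fun f => (freeNorm fun z : E →L[ℂ] ℂ => f (rePart z)).toReal⟩

theorem norm_def (f : FBLC E) :
    ‖f‖ = (freeNorm fun z : E →L[ℂ] ℂ => f (rePart z)).toReal := rfl

theorem freeNorm_rePart_le (f : (E →L[ℝ] ℝ) → ℝ) :
    freeNorm (fun z : E →L[ℂ] ℂ => f (rePart z)) ≤ freeNorm f := by
  refine freeNorm_le fun n z hz => le_freeNorm f (fun i => rePart (z i)) fun w hw => ?_
  exact (Finset.sum_le_sum fun i _ => Complex.abs_re_le_norm (z i w)).trans (hz w hw)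

theorem freeNorm_le_re_add_im (f : FBLC E) :
    freeNorm (fun z : E →L[ℂ] ℂ => f (rePart z)) ≤
      freeNorm (f.re : (E →L[ℝ] ℝ) → ℝ) + freeNorm (f.im : (E →L[ℝ] ℝ) → ℝ) :=
  (freeNorm_add_of_le fun z => Complex.norm_le_abs_re_add_abs_im (f (rePart z))).trans
    (add_le_add (freeNorm_rePart_le _) (freeNorm_rePart_le _))

theorem norm_ne_top (f : FBLC E) : freeNorm (fun z : E →L[ℂ] ℂ => f (rePart z)) ≠ ∞ :=
  ((freeNorm_le_re_add_im f).trans_lt (ENNReal.add_lt_top.2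
    ⟨(isClosedSublattice_FBL.le_H1 f.re.2).2, (isClosedSublattice_FBL.le_H1 f.im.2).2⟩)).ne

theorem smul_nonneg (f : FBLC E) {c : ℝ} (hc : 0 ≤ c) (x : E →L[ℝ] ℝ) :
    f (c • x) = c * f x := by
  apply Complex.ext
  · have h : (f (c • x)).re = c * (f x).re := (isClosedSublattice_FBL.le_H1 f.re.2).1 c x hc
    simpa using h
  · have h : (f (c • x)).im = c * (f x).im := (isClosedSublattice_FBL.le_H1 f.im.2).1 c x hc
    simpa using h

theorem exists_rePart (x : E →L[ℝ] ℝ) : ∃ z : E →L[ℂ] ℂ, rePart z = x := by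
  refine ⟨StrongDual.extendRCLike (𝕜 := ℂ) x, ?_⟩
  ext w
  simp [rePart, StrongDual.extendRCLike_apply]

theorem eq_zero_of_norm (f : FBLC E) (h : ‖f‖ = 0) : f = 0 := by
  have h0 : freeNorm (fun z : E →L[ℂ] ℂ => f (rePart z)) = 0 :=
    ((ENNReal.toReal_eq_zero_iff _).1 h).resolve_right (norm_ne_top f)
  ext x
  obtain ⟨z, rfl⟩ := exists_rePart x
  have hz : 0 < ‖z‖ + 1 := by positivity
  have h1 : ‖f (rePart ((‖z‖ + 1)⁻¹ • z))‖ₑ ≤ 0 := by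
    rw [← h0]
    refine le_trans (by simp) (le_freeNorm (fun z : E →L[ℂ] ℂ => f (rePart z))
      (fun _ : Fin 1 => (‖z‖ + 1)⁻¹ • z) fun w hw => ?_)
    simp only [Finset.univ_unique, Finset.sum_const, Finset.card_singleton, one_smul]
    rw [_root_.smul_apply, norm_smul, Real.norm_of_nonneg (by positivity),
      inv_mul_le_iff₀ hz]
    have := z.le_opNorm w
    nlinarith [norm_nonneg z, norm_nonneg w]
  have h2 : rePart ((‖z‖ + 1)⁻¹ • z) = (‖z‖ + 1)⁻¹ • rePart z := by
    ext w; simp [rePart]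
  rw [h2, smul_nonneg f (by positivity)] at h1
  have h3 := enorm_eq_zero.1 (le_antisymm h1 zero_le)
  exact (mul_eq_zero.1 h3).resolve_left (by exact_mod_cast (inv_pos.2 hz).ne')

theorem normCore : NormedSpace.Core ℂ (FBLC E) where
  norm_nonneg _ := ENNReal.toReal_nonneg
  norm_smul c f := by
    rw [norm_def, norm_def]
    have := freeNorm_smul_eq c fun z : E →L[ℂ] ℂ => f (rePart z)
    simp only [smul_eq_mul] at this
    simp [this]
  norm_triangle f g := by
    rw [norm_def, norm_def, norm_def, ← ENNReal.toReal_add (norm_ne_top f) (norm_ne_top g)]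
    exact ENNReal.toReal_mono (ENNReal.add_ne_top.2 ⟨norm_ne_top f, norm_ne_top g⟩)
      (freeNorm_add_of_le fun z => norm_add_le _ _)
  norm_eq_zero_iff f := by
    refine ⟨eq_zero_of_norm f, ?_⟩
    rintro rfl
    simp [norm_def, freeNorm]

instance : NormedAddCommGroup (FBLC E) := NormedAddCommGroup.ofCore normCore

instance : NormedSpace ℂ (FBLC E) := NormedSpace.ofCore normCore

theorem norm_eq (f : FBLC E) :
    ‖f‖ = (freeNorm fun z : E →L[ℂ] ℂ => f (rePart z)).toReal := rfl

end FBLC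

/-- The canonical embedding `δ_E(z) = δ_{E_ℝ}(z) - i δ_{E_ℝ}(iz)`. -/
def delta (z : E) : FBLC E :=
  FBLC.mk ⟨evalAt z, evalAt_mem z⟩ (-⟨evalAt (Complex.I • z), evalAt_mem _⟩)

/-- A complex lattice homomorphism of `FBL_ℂ[E]`: the complexification of a (real-linear)
lattice homomorphism of `FBL[E_ℝ]`. -/
def IsComplexLatticeHom (S : FBLC E →L[ℂ] FBLC E) : Prop :=
  ∃ R : FBL E →ₗ[ℝ] FBL E,
    (∀ f g, R (f ⊔ g) = R f ⊔ R g) ∧ (∀ f g, R (f ⊓ g) = R f ⊓ R g) ∧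
      ∀ f g : FBL E, S (FBLC.mk f g) = FBLC.mk (R f) (R g)

theorem freeNorm_comp_le {𝕜 X V : Type*} [RCLike 𝕜] [NormedAddCommGroup X] [NormedSpace 𝕜 X]
    [NormedAddCommGroup V] (T : X →L[𝕜] X) {f : (X →L[𝕜] 𝕜) → V}
    (hf : ∀ (c : ℝ) (x : X →L[𝕜] 𝕜), 0 ≤ c → ‖f ((c : 𝕜) • x)‖ = c * ‖f x‖) :
    freeNorm (fun x => f (x.comp T)) ≤ ENNReal.ofReal (‖T‖ + 1) * freeNorm f := by
  have hT : 0 < ‖T‖ + 1 := by positivity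
  refine freeNorm_le fun n x hx => ?_
  have h := le_freeNorm f (fun i => (((‖T‖ + 1)⁻¹ : ℝ) : 𝕜) • (x i).comp T) fun z hz => by
    have := hx ((((‖T‖ + 1)⁻¹ : ℝ) : 𝕜) • T z) (by
      rw [norm_smul, RCLike.norm_ofReal, abs_of_pos (by positivity), inv_mul_le_iff₀ hT]
      nlinarith [T.le_opNorm z, norm_nonneg T, norm_nonneg z])
    simpa using this
  calc ∑ i, ‖f ((x i).comp T)‖ₑ
      = ENNReal.ofReal (‖T‖ + 1) * ∑ i, ‖f ((((‖T‖ + 1)⁻¹ : ℝ) : 𝕜) • (x i).comp T)‖ₑ := by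
        rw [Finset.mul_sum]
        refine Finset.sum_congr rfl fun i _ => ?_
        rw [← ofReal_norm, ← ofReal_norm, hf _ _ (by positivity), ← ENNReal.ofReal_mul hT.le,
          mul_inv_cancel_left₀ hT.ne']
    _ ≤ _ := by gcongr

theorem comp_mem_FBL {F : Type*} [NormedAddCommGroup F] [NormedSpace ℝ F] (T : F →L[ℝ] F)
    {f : (F →L[ℝ] ℝ) → ℝ} (hf : f ∈ FBL F) : (fun x => f (x.comp T)) ∈ FBL F := by
  let L : ((F →L[ℝ] ℝ) → ℝ) →ₗ[ℝ] ((F →L[ℝ] ℝ) → ℝ) := LinearMap.funLeft ℝ ℝ fun x => x.comp T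
  have hH : ∀ f ∈ H1 F, freeNorm (L f) ≤ ENNReal.ofReal (‖T‖ + 1) * freeNorm f := fun f hf =>
    freeNorm_comp_le T fun c x hc => by
      have := hf.1 c x hc
      simp only [RCLike.ofReal_real_eq_id, id_eq, this, norm_mul, Real.norm_of_nonneg hc]
  have key : FBL F ≤ H1 F ⊓ (FBL F).comap L := by
    refine FBL_le ⟨inf_le_left, ?_, ?_⟩ ?_
    · rintro f ⟨hf1, hf2⟩ g ⟨hg1, hg2⟩
      exact ⟨isClosedSublattice_H1.sup_mem f hf1 g hg1,
        isClosedSublattice_FBL.sup_mem _ hf2 _ hg2⟩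
    · intro f hf h
      refine ⟨hf, isClosedSublattice_FBL.closed _ ⟨fun c x hc => ?_, ?_⟩ fun ε hε => ?_⟩
      · have := hf.1 c (x.comp T) hc
        simpa [L, LinearMap.funLeft_apply] using this
      · exact (hH f hf).trans_lt (ENNReal.mul_lt_top ENNReal.ofReal_lt_top hf.2)
      · have hC : ENNReal.ofReal (‖T‖ + 1) ≠ 0 := by
          rw [Ne, ENNReal.ofReal_eq_zero, not_le]; positivity
        obtain ⟨g, hg, hg'⟩ := h (ε / ENNReal.ofReal (‖T‖ + 1))
          (ENNReal.div_pos hε.ne' ENNReal.ofReal_ne_top)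
        refine ⟨L g, hg.2, ?_⟩
        rw [← map_sub]
        refine (hH _ ((H1 F).sub_mem hf hg.1)).trans_lt ?_
        rw [mul_comm]
        exact ENNReal.mul_lt_of_lt_div hg'
    · intro x
      exact ⟨evalAt_mem_H1 x, evalAt_mem (T x)⟩
  exact (key hf).2

/-- Composition with the adjoint, `f ↦ f ∘ T^*`, on `FBL_ℂ[E]`. -/
def compHom (T : E →L[ℂ] E) : FBLC E →L[ℂ] FBLC E :=
  LinearMap.mkContinuous
    { toFun := fun f => ⟨fun x => f (x.comp (T.restrictScalars ℝ)),
        comp_mem_FBL (T.restrictScalars ℝ) f.2.1, comp_mem_FBL (T.restrictScalars ℝ) f.2.2⟩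
      map_add' := fun _ _ => rfl
      map_smul' := fun _ _ => rfl }
    (‖T‖ + 1) fun f => by
      have h := freeNorm_comp_le T (f := fun z : E →L[ℂ] ℂ => f (rePart z)) fun c z hc => by
        have : rePart ((c : ℂ) • z) = c • rePart z := by ext w; simp [rePart]
        simp only [Complex.coe_algebraMap, this, FBLC.smul_nonneg f hc, norm_mul,
          Complex.norm_real, Real.norm_of_nonneg hc]
      have h' := ENNReal.toReal_mono
        (ENNReal.mul_ne_top ENNReal.ofReal_ne_top (FBLC.norm_ne_top f)) h
      rwa [ENNReal.toReal_mul, ENNReal.toReal_ofReal (by positivity)] at h'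

theorem compHom_apply (T : E →L[ℂ] E) (f : FBLC E) (x : E →L[ℝ] ℝ) :
    compHom T f x = f (x.comp (T.restrictScalars ℝ)) := rfl

theorem compHom_delta (T : E →L[ℂ] E) (z : E) : compHom T (delta z) = delta (T z) := by
  ext x
  apply Complex.ext
  · rfl
  · change -(x (T (Complex.I • z))) = -(x (Complex.I • T z))
    rw [map_smul]

theorem isComplexLatticeHom_compHom (T : E →L[ℂ] E) : IsComplexLatticeHom (compHom T) :=
  ⟨{ toFun := fun f => ⟨_, comp_mem_FBL (T.restrictScalars ℝ) f.2⟩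
     map_add' := fun _ _ => rfl
     map_smul' := fun _ _ => rfl }, fun _ _ => rfl, fun _ _ => rfl, fun _ _ => rfl⟩

/-- Complex lattice homomorphisms that agree on the range of `δ_E` are equal. -/
theorem latticeHom_ext {S S' : FBLC E →L[ℂ] FBLC E} (hS : IsComplexLatticeHom S)
    (hS' : IsComplexLatticeHom S') (h : ∀ z, S (delta z) = S' (delta z)) : S = S' := by
  obtain ⟨R, hR, -, hRS⟩ := hS
  obtain ⟨R', hR', -, hRS'⟩ := hS'
  have hre : ∀ a b a' b' : FBL E, FBLC.mk a b = FBLC.mk a' b' → a = a' := by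
    intro a b a' b' hab
    exact congrArg FBLC.re hab
  have key : FBL E ≤ (LinearMap.eqLocus R R').map (FBL E).subtype := by
    refine FBL_le ⟨?_, ?_, ?_⟩ ?_
    · rintro _ ⟨f, -, rfl⟩
      exact isClosedSublattice_FBL.le_H1 f.2
    · rintro _ ⟨f, hf, rfl⟩ _ ⟨g, hg, rfl⟩
      refine ⟨f ⊔ g, ?_, rfl⟩
      change R (f ⊔ g) = R' (f ⊔ g)
      rw [hR, hR', show R f = R' f from hf, show R g = R' g from hg]
    · intro f hf hcl
      have hfm : f ∈ FBL E := isClosedSublattice_FBL.closed f hf fun ε hε => by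
        obtain ⟨_, ⟨g, -, rfl⟩, hg'⟩ := hcl ε hε
        exact ⟨_, g.2, hg'⟩
      refine ⟨⟨f, hfm⟩, ?_, rfl⟩
      have hmem : FBLC.mk ⟨f, hfm⟩ 0 ∈ closure {u : FBLC E | S u = S' u} := by
        rw [Metric.mem_closure_iff]
        intro ε hε
        obtain ⟨_, ⟨g, hg, rfl⟩, hg'⟩ := hcl (ENNReal.ofReal ε) (ENNReal.ofReal_pos.2 hε)
        refine ⟨FBLC.mk g 0, ?_, ?_⟩
        · change S _ = S' _
          rw [hRS, hRS', show R g = R' g from hg, map_zero, map_zero]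
        · rw [dist_eq_norm, FBLC.norm_eq]
          have h1 := FBLC.freeNorm_le_re_add_im (FBLC.mk ⟨f, hfm⟩ 0 - FBLC.mk g 0)
          have h2 : freeNorm ((FBLC.mk ⟨f, hfm⟩ 0 - FBLC.mk g 0 : FBLC E).im :
              (E →L[ℝ] ℝ) → ℝ) = 0 := by
            have h5 : ((FBLC.mk ⟨f, hfm⟩ 0 - FBLC.mk g 0 : FBLC E).im :
                (E →L[ℝ] ℝ) → ℝ) = fun _ => 0 := by
              funext x
              exact sub_self (0 : ℝ)
            rw [h5]
            simp [freeNorm]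
          rw [h2, add_zero] at h1
          have h3 := h1.trans_lt hg'
          exact (ENNReal.lt_ofReal_iff_toReal_lt h3.ne_top).1 h3
      rw [(isClosed_eq S.continuous S'.continuous).closure_eq] at hmem
      have h4 : S _ = S' _ := hmem
      rw [hRS, hRS'] at h4
      exact hre _ _ _ _ h4
    · intro x
      refine ⟨⟨evalAt x, evalAt_mem x⟩, ?_, rfl⟩
      have h4 := h x
      unfold delta at h4
      rw [hRS, hRS'] at h4
      exact hre _ _ _ _ h4
  have hRR : ∀ f, R f = R' f := by
    intro f
    obtain ⟨g, hg, hgf⟩ := key f.2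
    obtain rfl : g = f := Subtype.ext hgf
    exact hg
  ext1 u
  change S (FBLC.mk u.re u.im) = S' (FBLC.mk u.re u.im)
  rw [hRS, hRS', hRR, hRR]

theorem existsUnique_extension (T : E →L[ℂ] E) :
    ∃! S : FBLC E →L[ℂ] FBLC E, IsComplexLatticeHom S ∧ ∀ z, S (delta z) = delta (T z) :=
  ⟨compHom T, ⟨isComplexLatticeHom_compHom T, compHom_delta T⟩, fun S hS =>
    latticeHom_ext hS.1 (isComplexLatticeHom_compHom T) fun z => by
      rw [hS.2, compHom_delta]⟩

/-- The operator `T̄`: the unique lattice homomorphism of `FBL_ℂ[E]` with `T̄ δ_E = δ_E T`. -/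
def extension (T : E →L[ℂ] E) : FBLC E →L[ℂ] FBLC E := (existsUnique_extension T).choose

end Complex

end FreeBL

end

namespace FreeBL

/-! ### The embedding `delta` as a complex linear isometry. -/

section Spectrum

variable {E : Type*} [NormedAddCommGroup E] [NormedSpace ℂ E]

/-! By contraposition: if `r - T̄` has an inverse `S`, then `r - T` is bounded below and has dense
range, hence is bijective because `E` is complete. The lower bound is inherited through `delta`,
which is linear, isometric (`norm_delta`) and intertwines `T` with `T̄`, so that `‖z‖ ≤ ‖S‖ ‖(r - T)
z‖`. If the range were not dense, Hahn–Banach would give `w ≠ 0` with `T^* w = r w`. Since `T̄ f = f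
∘ T^*` (`extension_eq_compHom`) and every `f` is positively homogeneous, `r ≥ 0` makes `r f - T̄ f`
vanish at `Re w` for all `f`. By surjectivity of `r - T̄` every element then vanishes there, in
particular each `delta u`, whose value is `w u`; so `w = 0`. -/

theorem delta_apply_rePart (z : E) (w : E →L[ℂ] ℂ) : delta z (rePart w) = w z := by
  apply Complex.ext
  · rfl
  · change -(w (Complex.I • z)).re = (w z).im
    simp

theorem norm_delta (z : E) : ‖delta z‖ = ‖z‖ := by
  have hfun : (fun w : E →L[ℂ] ℂ => delta z (rePart w)) = fun w => w z :=
    funext (delta_apply_rePart z)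
  rw [FBLC.norm_def, hfun]
  have hle : freeNorm (fun w : E →L[ℂ] ℂ => w z) ≤ ENNReal.ofReal ‖z‖ := by
    refine freeNorm_le fun n w hw => ?_
    simp only [← ofReal_norm]
    rw [← ENNReal.ofReal_sum_of_nonneg fun _ _ => norm_nonneg _]
    refine ENNReal.ofReal_le_ofReal ?_
    rcases eq_or_ne z 0 with rfl | hz
    · simp
    · have hz' : 0 < ‖z‖ := norm_pos_iff.2 hz
      -- Testing the constraint on the unit vector `z / ‖z‖` bounds each admissible sum by `‖z‖`.
      have := hw (((‖z‖⁻¹ : ℝ) : ℂ) • z) (by simp [norm_smul, hz'.ne'])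
      simp only [map_smul, norm_smul, Complex.norm_real, norm_inv, norm_norm,
        ← Finset.mul_sum] at this
      rwa [inv_mul_le_iff₀ hz', mul_one] at this
  have hge : ENNReal.ofReal ‖z‖ ≤ freeNorm (fun w : E →L[ℂ] ℂ => w z) := by
    -- A norming functional for `z`, taken as a one-term admissible family, attains the bound.
    obtain ⟨g, hg, hgz⟩ := exists_dual_vector'' ℂ z
    refine le_trans ?_ (le_freeNorm (fun w : E →L[ℂ] ℂ => w z) (fun _ : Fin 1 => g)
      fun y hy => ?_)
    · simp [← ofReal_norm, hgz]
    · simpa using (g.le_of_opNorm_le hg y).trans (by simpa using hy)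
  rw [le_antisymm hle hge, ENNReal.toReal_ofReal (norm_nonneg z)]

/-- Every real functional is the real part of a complex one, and at such points `delta z` is
evaluation at `z`; linearity, also over `ℂ` in `delta_smul`, is read off there. -/
theorem delta_sub (y z : E) : delta (y - z) = delta y - delta z := by
  ext x
  obtain ⟨w, rfl⟩ := FBLC.exists_rePart x
  simp [delta_apply_rePart]

theorem delta_smul (c : ℂ) (z : E) : delta (c • z) = c • delta z := by
  ext x
  obtain ⟨w, rfl⟩ := FBLC.exists_rePart x
  simp [delta_apply_rePart]

/-! ### Concrete form of `T̄`, and annihilators of a non-dense range. -/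

theorem extension_delta (T : E →L[ℂ] E) (z : E) : extension T (delta z) = delta (T z) :=
  (existsUnique_extension T).choose_spec.1.2 z

/-- Turns the universal property into a pointwise formula, which is what allows evaluating `T̄ f` at
an eigenvector of the adjoint. -/
theorem extension_eq_compHom (T : E →L[ℂ] E) : extension T = compHom T :=
  latticeHom_ext (existsUnique_extension T).choose_spec.1.1 (isComplexLatticeHom_compHom T)
    fun z => by rw [extension_delta, compHom_delta]

/-- An operator without dense range has a nonzero functional in the kernel of its adjoint. -/
theorem exists_dual_ne_zero_of_closure_range_ne_top {A : E →L[ℂ] E}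
    (hA : A.range.topologicalClosure ≠ ⊤) :
    ∃ w : E →L[ℂ] ℂ, w ≠ 0 ∧ ∀ z, w (A z) = 0 := by
  let p : Submodule ℂ E := A.range.topologicalClosure
  have hmem : ∀ z, A z ∈ p := fun z => A.range.le_topologicalClosure ⟨z, rfl⟩
  obtain ⟨x, hx⟩ : ∃ x, x ∉ p := by
    by_contra! h
    exact hA (Submodule.eq_top_iff'.2 h)
  -- Closedness makes `E ⧸ p` a normed space, so a functional there separates the class of `x` from
  -- zero; it is pulled back to `E`.
  have : IsClosed (p : Set E) := A.range.isClosed_topologicalClosure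
  obtain ⟨g, hg⟩ := SeparatingDual.exists_ne_zero (R := ℂ)
    (x := p.mkQ x) (by simpa using hx)
  refine ⟨g.comp p.mkQL, fun h => hg (DFunLike.congr_fun h x), fun z => ?_⟩
  have hz : p.mkQ (A z) = 0 := by simpa using hmem z
  change g (p.mkQ (A z)) = 0
  rw [hz, map_zero]

end Spectrum

end FreeBL

/-! ### Transfer of invertibility from `T̄` to `T`. -/

theorem mainTheorem8 {E : Type*} [NormedAddCommGroup E] [NormedSpace ℂ E] [CompleteSpace E]
    (T : E →L[ℂ] E) (r : ℝ) (hr : 0 ≤ r) (hrT : (r : ℂ) ∈ spectrum ℂ T) :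
    (r : ℂ) ∈ spectrum ℂ (FreeBL.extension T) := by
  rw [spectrum.mem_iff] at hrT ⊢
  contrapose! hrT
  obtain ⟨S, hSl, hSr⟩ := isUnit_iff_exists.1 hrT
  rw [ContinuousLinearMap.isUnit_iff_bijective,
    ContinuousLinearMap.bijective_iff_dense_range_and_antilipschitz]
  have hA : ∀ z : E, (algebraMap ℂ (E →L[ℂ] E) r - T) z = (r : ℂ) • z - T z := fun z => by
    simp [Algebra.algebraMap_eq_smul_one]
  have hB : ∀ f, (algebraMap ℂ (FreeBL.FBLC E →L[ℂ] FreeBL.FBLC E) r - FreeBL.extension T) f =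
      (r : ℂ) • f - FreeBL.extension T f := fun f => by
    simp [Algebra.algebraMap_eq_smul_one]
  constructor
  · by_contra hd
    obtain ⟨w, hw, hwA⟩ := FreeBL.exists_dual_ne_zero_of_closure_range_ne_top hd
    obtain ⟨u, hu⟩ := DFunLike.ne_iff.1 hw
    -- As `r` is real, taking real parts in `w ∘ T = r w` keeps the eigenvalue equation.
    have hwT : (FreeBL.rePart w).comp (T.restrictScalars ℝ) = r • FreeBL.rePart w := by
      ext z
      have h := hwA z
      rw [hA, map_sub, map_smul, sub_eq_zero] at h
      have h' := congrArg Complex.re h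
      simpa [FreeBL.rePart] using h'.symm
    have h1 := DFunLike.congr_fun hSl (FreeBL.delta u)
    rw [mul_apply_eq_comp, hB, FreeBL.extension_eq_compHom,
      one_apply_eq_self] at h1
    apply hu
    -- With `f = S (delta u)`, the value `w u` becomes `r f(Re w) - f(r Re w)`, which is zero by
    -- homogeneity; this is where `0 ≤ r` enters.
    rw [← FreeBL.delta_apply_rePart, ← h1, FreeBL.FBLC.sub_apply, FreeBL.compHom_apply, hwT,
      FreeBL.FBLC.smul_nonneg _ hr, FreeBL.FBLC.smul_apply, sub_self, zero_apply]
  · refine ⟨‖S‖₊, ContinuousLinearMap.antilipschitz_of_bound _ fun z => ?_⟩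
    have h1 := DFunLike.congr_fun hSr (FreeBL.delta z)
    rw [mul_apply_eq_comp, hB, FreeBL.extension_delta,
      one_apply_eq_self, ← FreeBL.delta_smul, ← FreeBL.delta_sub, ← hA] at h1
    calc ‖z‖ = ‖S (FreeBL.delta _)‖ := by rw [h1, FreeBL.norm_delta]
      _ ≤ ‖S‖ * ‖FreeBL.delta _‖ := S.le_opNorm _
      _ = _ := by rw [FreeBL.norm_delta, coe_nnnorm]
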